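/- Let $D\ge 1$ and let $C_0\subseteq\mathbb{R}^D$ be a convex cone (the system cone), i.e. a set with $\alpha x+\beta y\in C_0$ for all $x,y\in C_0$ and $\alpha,\beta>0$. Let the user tokens $u_1,u_2,\dots$ be i.i.d. random vectors, each uniformly distributed on the unit sphere $\mathbb{S}^{D-1}\subset\mathbb{R}^D$, and for $n\ge 0$ let $C_n$ be the smallest convex cone containing $C_0\cup\{u_1,\dots,u_n\}$. Then for every $\eta>0$, with probability at least $1-\eta$ one has $$C_n=\mathbb{R}^D\quad\text{for all integers } n\ge 4D+2\log\frac1\eta ,$$ where $\log$ is the natural logarithm. -/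

import Mathlib

open MeasureTheory ProbabilityTheory

/-- The uniform probability distribution on the unit sphere of `ℝ^D`: the surface measure
induced by Lebesgue measure, normalized to total mass one. -/
noncomputable def uniformSphere (D : ℕ) :
    Measure (Metric.sphere (0 : EuclideanSpace ℝ (Fin D)) 1) :=
  ((volume : Measure (EuclideanSpace ℝ (Fin D))).toSphere Set.univ)⁻¹ •
    (volume : Measure (EuclideanSpace ℝ (Fin D))).toSphere

/-- In positive dimension the normalization is a genuine one. -/
theorem isProbabilityMeasure_uniformSphere {D : ℕ} (hD : 1 ≤ D) :
    IsProbabilityMeasure (uniformSphere D) := by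
  haveI : Nonempty (Fin D) := ⟨⟨0, hD⟩⟩
  refine ⟨?_⟩
  rw [uniformSphere, Measure.smul_apply, smul_eq_mul]
  refine ENNReal.inv_mul_cancel ?_ (measure_ne_top _ _)
  rw [Ne, Measure.measure_univ_eq_zero]
  exact Measure.toSphere_ne_zero _

/-- The smallest convex cone containing the system cone `C₀` and the first `n` user tokens
`u 0, …, u (n - 1)`. -/
def expandedCone {D : ℕ} (C₀ : ConvexCone ℝ (EuclideanSpace ℝ (Fin D)))
    (u : ℕ → EuclideanSpace ℝ (Fin D)) (n : ℕ) : ConvexCone ℝ (EuclideanSpace ℝ (Fin D)) :=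
  ConvexCone.hull ℝ ((C₀ : Set (EuclideanSpace ℝ (Fin D))) ∪ u '' {i | i < n})

/-! If the first `N` tokens do not generate `ℝ^D` as a cone, they lie in a closed half-space.
Flipping signs of tokens preserves their joint law, so the probability of this equals `2⁻ᴺ` times
the expected number of sign choices that bring the tokens into a half-space (Wendel's
symmetrization). Almost surely the tokens are in general position; then these sign choices have VC
dimension at most `D`, and a Sauer–Shelah count (`card_signPatterns_le`) bounds their number by `5 ^
D * (6 / 5) ^ N`. The resulting `5 ^ D * (3 / 5) ^ N` is at most `η`, and larger `n` only enlarges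
the cone. -/

/-- The vectors `x i` all lie in a common closed half-space through the origin. -/
def InHalfspace {ι E : Type*} [NormedAddCommGroup E] [InnerProductSpace ℝ E] (x : ι → E) : Prop :=
  ∃ v : E, ‖v‖ = 1 ∧ ∀ i, 0 ≤ inner ℝ v (x i)

/-! ### Separation and cones generated by finitely many vectors -/

section Cone

variable {E : Type*} [NormedAddCommGroup E] [InnerProductSpace ℝ E] [FiniteDimensional ℝ E]

/-- A point outside a compact convex set is strictly separated from it by a unit vector. -/
theorem exists_unit_inner_lt_of_notMem {K : Set E} (hK : Convex ℝ K) (hc : IsClosed K)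
    (hne : K.Nonempty) {x : E} (hx : x ∉ K) :
    ∃ v : E, ‖v‖ = 1 ∧ ∀ y ∈ K, inner ℝ v x < inner ℝ v y := by
  obtain ⟨f, a, hfx, hfK⟩ := geometric_hahn_banach_point_closed hK hc hx
  set w := (InnerProductSpace.toDual ℝ E).symm f with hw
  have hfw : ∀ y, f y = inner ℝ w y := fun y => by
    rw [hw, InnerProductSpace.toDual_symm_apply]
  obtain ⟨y₀, hy₀⟩ := hne
  have hw0 : w ≠ 0 := by
    intro h0
    have h1 := hfK y₀ hy₀
    rw [hfw, h0, inner_zero_left] at h1 hfx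
    linarith
  have hn : 0 < ‖w‖ := norm_pos_iff.2 hw0
  refine ⟨‖w‖⁻¹ • w, norm_smul_inv_norm hw0, fun y hy => ?_⟩
  rw [real_inner_smul_left, real_inner_smul_left, ← hfw, ← hfw]
  exact mul_lt_mul_of_pos_left (hfx.trans (hfK y hy)) (inv_pos.2 hn)

/-- Finitely many vectors that lie in no closed half-space generate the whole space as a
convex cone. -/
theorem hull_range_eq_univ_of_not_inHalfspace {ι : Type*} [Finite ι] [Nonempty ι] {x : ι → E}
    (hx : ¬ InHalfspace x) : (ConvexCone.hull ℝ (Set.range x) : Set E) = Set.univ := by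
  refine Set.eq_univ_of_forall fun y => ?_
  by_contra hy
  apply hx
  set K := convexHull ℝ (Set.range x) with hKdef
  have hKc : IsClosed K := (Set.finite_range x).isClosed_convexHull ℝ
  have hKx : ∀ i, x i ∈ K := fun i => subset_convexHull ℝ _ ⟨i, rfl⟩
  have hKne : K.Nonempty := ⟨_, hKx (Classical.arbitrary ι)⟩
  have hKH : K ⊆ (ConvexCone.hull ℝ (Set.range x) : Set E) :=
    convexHull_min ConvexCone.subset_hull (ConvexCone.convex _)
  -- The hull cone need not be closed, so the shrinking multiples of `y` are separated from the
  -- compact `K` instead. They tend to `0`, so a limit of the separating vectors is nonnegative on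
  -- every `x i`.
  have hout : ∀ n : ℕ, (1 / ((n : ℝ) + 1)) • y ∉ K := by
    intro n hn
    apply hy
    have hpos : (0 : ℝ) < n + 1 := by positivity
    have := (ConvexCone.hull ℝ (Set.range x)).smul_mem hpos (hKH hn)
    rwa [smul_smul, mul_one_div_cancel hpos.ne', one_smul] at this
  choose v hv hlt using fun n => exists_unit_inner_lt_of_notMem (convex_convexHull ℝ _) hKc hKne
    (hout n)
  obtain ⟨w, hw, φ, hφ, hlim⟩ := (isCompact_sphere (0 : E) 1).tendsto_subseq
    (x := v) (fun n => by simpa using hv n)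
  refine ⟨w, by simpa using hw, fun i => ?_⟩
  have h1 : Filter.Tendsto (fun n => inner ℝ (v (φ n)) (x i)) Filter.atTop
      (nhds (inner ℝ w (x i))) := hlim.inner tendsto_const_nhds
  have h2 : Filter.Tendsto (fun n => inner ℝ (v (φ n)) ((1 / (((φ n : ℕ) : ℝ) + 1)) • y))
      Filter.atTop (nhds (inner ℝ w ((0 : ℝ) • y))) :=
    hlim.inner ((tendsto_one_div_add_atTop_nhds_zero_nat.comp hφ.tendsto_atTop).smul_const y)
  rw [zero_smul, inner_zero_right] at h2
  exact le_of_tendsto_of_tendsto' h2 h1 fun n => (hlt (φ n) _ (hKx i)).le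

end Cone

/-! ### Counting sign patterns by VC dimension -/

section Patterns

variable {ι E : Type*} [Fintype ι] [DecidableEq ι] [NormedAddCommGroup E] [InnerProductSpace ℝ E]

open scoped Classical in
/-- The sets of indices whose complementary vectors may be reversed so as to bring the whole
family into a half-space. -/
noncomputable def signPatterns (x : ι → E) : Finset (Finset ι) :=
  {s | InHalfspace fun i => if i ∈ s then x i else -x i}

/-- Closed half-spaces through the origin have VC dimension at most the dimension of the space on
vectors in general position. -/
theorem card_le_of_shatters_signPatterns [FiniteDimensional ℝ E] {x : ι → E}
    (hx : ∀ s : Finset ι, s.card = Module.finrank ℝ E → LinearIndepOn ℝ x (s : Set ι))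
    {s : Finset ι} (hs : (signPatterns x).Shatters s) : s.card ≤ Module.finrank ℝ E := by
  by_contra! hcard
  obtain ⟨t, hts, htc⟩ := Finset.exists_subset_card_eq (Nat.succ_le_of_lt hcard)
  replace hs := hs.mono_right hts
  have hdep : ¬ LinearIndepOn ℝ x (t : Set ι) := by
    intro h
    have := LinearIndependent.fintype_card_le_finrank h
    simp at this
    omega
  rw [linearIndepOn_finset_iff] at hdep
  push Not at hdep
  obtain ⟨c, hc0, i₀, hi₀, hci₀⟩ := hdep
  -- Removing any one vector from `t` leaves a basis, so every coefficient of the dependence is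
  -- nonzero.
  have hgp : ∀ j ∈ t, LinearIndepOn ℝ x ((t.erase j : Finset ι) : Set ι) := fun j hj =>
    hx _ (by rw [Finset.card_erase_of_mem hj, htc]; rfl)
  have hc : ∀ j ∈ t, c j ≠ 0 := by
    intro j hj hcj
    have h0 := linearIndepOn_finset_iff.1 (hgp j hj) c (by
      rw [← hc0, ← Finset.add_sum_erase t _ hj, hcj, zero_smul, zero_add]) i₀
    exact hci₀ (h0 (Finset.mem_erase.2 ⟨fun h => hci₀ (h ▸ hcj), hi₀⟩))
  -- Signs chosen to match those of `c` make all terms of `∑ c i * ⟪v, x i⟫ = 0` nonnegative, hence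
  -- zero; then `v` is orthogonal to a basis.
  obtain ⟨a, ha, hat⟩ := hs (Finset.filter_subset (fun i => 0 < c i) t)
  simp only [signPatterns, Finset.mem_filter, Finset.mem_univ, true_and] at ha
  obtain ⟨v, hv, hva⟩ := ha
  have hmem : ∀ i ∈ t, (i ∈ a ↔ 0 < c i) := fun i hi => by
    have := congrArg (i ∈ ·) hat
    simpa [hi] using this
  have hnn : ∀ i ∈ t, 0 ≤ c i * inner ℝ v (x i) := by
    intro i hi
    have h := hva i
    beta_reduce at h
    by_cases hia : i ∈ a
    · rw [if_pos hia] at h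
      exact mul_nonneg ((hmem i hi).1 hia).le h
    · rw [if_neg hia, inner_neg_right] at h
      exact mul_nonneg_of_nonpos_of_nonpos (not_lt.1 fun h' => hia ((hmem i hi).2 h'))
        (by linarith)
  have hsum : ∑ i ∈ t, c i * inner ℝ v (x i) = 0 := by
    have := congrArg (inner ℝ v) hc0
    simpa [inner_sum, real_inner_smul_right] using this
  have hzero : ∀ i ∈ t, inner ℝ v (x i) = 0 := fun i hi =>
    (mul_eq_zero.1 ((Finset.sum_eq_zero_iff_of_nonneg hnn).1 hsum i hi)).resolve_left (hc i hi)
  have hspan : Submodule.span ℝ (Set.range fun i : t.erase i₀ => x i) = ⊤ := by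
    refine LinearIndependent.span_eq_top_of_card_eq_finrank' (hgp i₀ hi₀) ?_
    rw [Fintype.card_coe, Finset.card_erase_of_mem hi₀, htc]
    rfl
  have hle : Submodule.span ℝ (Set.range fun i : t.erase i₀ => x i) ≤ (ℝ ∙ v)ᗮ := by
    rw [Submodule.span_le]
    rintro _ ⟨i, rfl⟩
    exact Submodule.mem_orthogonal_singleton_iff_inner_right.2
      (hzero _ (Finset.mem_of_mem_erase i.2))
  rw [hspan] at hle
  have hv0 := Submodule.mem_orthogonal_singleton_iff_inner_right.1 (hle (Submodule.mem_top (x := v)))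
  rw [real_inner_self_eq_norm_sq, hv] at hv0
  norm_num at hv0

/-- Pajor's form of Sauer–Shelah: a family has at most as many members as it shatters sets. Each
shattered `s` has weight `5 ^ (D - s.card) ≥ 1`, where `D` is the dimension, and the weights of all
subsets sum by the binomial theorem. -/
theorem card_signPatterns_le [FiniteDimensional ℝ E] {x : ι → E}
    (hx : ∀ s : Finset ι, s.card = Module.finrank ℝ E → LinearIndepOn ℝ x (s : Set ι)) :
    ((signPatterns x).card : ℝ) ≤ 5 ^ Module.finrank ℝ E * (6 / 5) ^ Fintype.card ι := by
  calc ((signPatterns x).card : ℝ) ≤ (signPatterns x).shatterer.card := by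
        exact_mod_cast Finset.card_le_card_shatterer _
    _ = ∑ s ∈ (signPatterns x).shatterer, (1 : ℝ) := by simp
    _ ≤ ∑ s ∈ (signPatterns x).shatterer, 5 ^ Module.finrank ℝ E * (1 / 5 : ℝ) ^ s.card := by
        refine Finset.sum_le_sum fun s hs => ?_
        have h := card_le_of_shatters_signPatterns hx (Finset.mem_shatterer.1 hs)
        rw [one_div, inv_pow, ← div_eq_mul_inv, one_le_div (by positivity)]
        exact pow_le_pow_right₀ (by norm_num) h
    _ ≤ ∑ s : Finset ι, 5 ^ Module.finrank ℝ E * (1 / 5 : ℝ) ^ s.card :=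
        Finset.sum_le_sum_of_subset_of_nonneg (Finset.subset_univ _) fun _ _ _ => by positivity
    _ = _ := by
        rw [← Finset.mul_sum]
        have := Fintype.sum_pow_mul_eq_add_pow ι (1 / 5 : ℝ) 1
        simp only [one_pow, mul_one] at this
        rw [this]
        norm_num

end Patterns

/-- Since `5 ≤ e ^ 2` and `3 / 5 ≤ e ^ (-1 / 2)`, the left side is at most `exp (2 * D - N / 2)`;
this is where the constants `4` and `2` come from. -/
theorem five_pow_mul_le {D N : ℕ} {η : ℝ} (hη : 0 < η)
    (hN : 4 * (D : ℝ) + 2 * Real.log (1 / η) ≤ N) : (5 : ℝ) ^ D * (3 / 5) ^ N ≤ η := by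
  have h5 : (5 : ℝ) ≤ Real.exp 2 := by
    have h := Real.exp_one_gt_d9
    have : Real.exp 2 = Real.exp 1 ^ 2 := by rw [← Real.exp_nat_mul]; norm_num
    rw [this]
    nlinarith
  have h35 : (3 / 5 : ℝ) ≤ Real.exp (-(1 / 2)) := by
    have h := Real.exp_one_lt_d9
    have h2 : Real.exp (-(1 / 2)) ^ 2 = (Real.exp 1)⁻¹ := by
      rw [← Real.exp_nat_mul, ← Real.exp_neg]; norm_num
    refine (sq_le_sq₀ (by norm_num) (Real.exp_pos _).le).1 ?_
    rw [h2, le_inv_comm₀ (by norm_num) (Real.exp_pos _)]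
    norm_num
    linarith
  calc (5 : ℝ) ^ D * (3 / 5) ^ N ≤ Real.exp 2 ^ D * Real.exp (-(1 / 2)) ^ N := by gcongr
    _ = Real.exp (D * 2 + N * (-(1 / 2))) := by
        rw [← Real.exp_nat_mul, ← Real.exp_nat_mul, ← Real.exp_add]
    _ ≤ Real.exp (Real.log η) := by
        rw [one_div, Real.log_inv] at hN
        gcongr
        linarith
    _ = η := Real.exp_log hη

/-! ### Null sets, symmetry and closed events on the sphere -/

section Sphere

variable {D : ℕ}

open Pointwise in
theorem uniformSphere_submodule {V : Submodule ℝ (EuclideanSpace ℝ (Fin D))} (hV : V ≠ ⊤) :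
    uniformSphere D {y | (y : EuclideanSpace ℝ (Fin D)) ∈ V} = 0 := by
  have hm : MeasurableSet {y : Metric.sphere (0 : EuclideanSpace ℝ (Fin D)) 1 |
      (y : EuclideanSpace ℝ (Fin D)) ∈ V} :=
    (V.closed_of_finiteDimensional.preimage continuous_subtype_val).measurableSet
  rw [uniformSphere, Measure.smul_apply, Measure.toSphere_apply' _ hm]
  have h0 : (volume : Measure (EuclideanSpace ℝ (Fin D))) (Set.Ioo (0 : ℝ) 1 •
      (Subtype.val '' {y : Metric.sphere (0 : EuclideanSpace ℝ (Fin D)) 1 |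
      (y : EuclideanSpace ℝ (Fin D)) ∈ V})) = 0 := by
    refine measure_mono_null ?_ (Measure.addHaar_submodule volume V hV)
    rintro _ ⟨r, -, _, ⟨y, hy, rfl⟩, rfl⟩
    exact V.smul_mem r hy
  rw [h0, mul_zero, smul_zero]

open Pointwise in
theorem measurePreserving_neg_uniformSphere :
    MeasurePreserving (fun y : Metric.sphere (0 : EuclideanSpace ℝ (Fin D)) 1 => -y)
      (uniformSphere D) (uniformSphere D) := by
  refine ⟨continuous_neg.measurable, Measure.ext fun s hs => ?_⟩
  rw [Measure.map_apply continuous_neg.measurable hs]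
  have hs' := continuous_neg.measurable hs
  rw [uniformSphere, Measure.smul_apply, Measure.smul_apply, Measure.toSphere_apply' _ hs,
    Measure.toSphere_apply' _ hs']
  congr 2
  rw [← Measure.measure_neg]
  congr 1
  ext z
  constructor
  · rintro ⟨r, hr, _, ⟨y, hy, rfl⟩, hz⟩
    exact ⟨r, hr, _, ⟨-y, hy, rfl⟩, by
      simp only [coe_neg_sphere, smul_neg]
      exact neg_eq_iff_eq_neg.2 hz⟩
  · rintro ⟨r, hr, _, ⟨y, hy, rfl⟩, rfl⟩
    exact ⟨r, hr, _, ⟨-y, by simpa using hy, rfl⟩, by simp [smul_neg]⟩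

/-- Projecting out the normal vector, which ranges over a compact sphere, is a closed map. This
makes the half-space event measurable. -/
theorem isClosed_inHalfspace {ι : Type*} :
    IsClosed {y : ι → Metric.sphere (0 : EuclideanSpace ℝ (Fin D)) 1 |
      InHalfspace fun i => (y i : EuclideanSpace ℝ (Fin D))} := by
  have hc : IsClosed {p : Metric.sphere (0 : EuclideanSpace ℝ (Fin D)) 1 ×
      (ι → Metric.sphere (0 : EuclideanSpace ℝ (Fin D)) 1) |
      ∀ i, 0 ≤ inner ℝ (p.1 : EuclideanSpace ℝ (Fin D)) (p.2 i : EuclideanSpace ℝ (Fin D))} := by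
    simp only [Set.ofPred_forall]
    exact isClosed_iInter fun i => isClosed_le continuous_const (by fun_prop)
  convert isClosedMap_snd_of_compactSpace _ hc
  ext y
  constructor
  · rintro ⟨v, hv, h⟩
    exact ⟨(⟨v, by simpa using hv⟩, y), h, rfl⟩
  · rintro ⟨⟨v, y⟩, h, rfl⟩
    exact ⟨v, by simp, h⟩

end Sphere

theorem isOpen_linearIndependent_comp {X ι E : Type*} [TopologicalSpace X] [Finite ι]
    [NormedAddCommGroup E] [NormedSpace ℝ E] {f : X → ι → E} (hf : Continuous f) :
    IsOpen {p | LinearIndependent ℝ (f p)} :=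
  isOpen_setOfPred_linearIndependent.preimage hf

/-! ### General position and symmetrization -/

section Probability

variable {D : ℕ} {Ω : Type*} [MeasurableSpace Ω] {P : Measure Ω} [IsProbabilityMeasure P]

/-- At most `D` distinct independent uniform points of the unit sphere of `ℝ^D` are almost surely
linearly independent. -/
theorem ae_linearIndepOn_uniformSphere {ι : Type*}
    {u : ι → Ω → Metric.sphere (0 : EuclideanSpace ℝ (Fin D)) 1}
    (hlaw : ∀ i, HasLaw (u i) (uniformSphere D) P) (hindep : iIndepFun u P) (s : Finset ι)
    (hs : s.card ≤ D) :
    ∀ᵐ ω ∂P, LinearIndepOn ℝ (fun i => (u i ω : EuclideanSpace ℝ (Fin D))) (s : Set ι) := by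
  classical
  induction s using Finset.induction_on with
  | empty => simp
  | insert a s ha ih =>
    rw [Finset.card_insert_of_notMem ha] at hs
    have ih' := ih (by omega)
    set Z : Ω → (s → Metric.sphere (0 : EuclideanSpace ℝ (Fin D)) 1) := fun ω i => u i ω with hZ
    have hZm : AEMeasurable Z P := aemeasurable_pi_lambda _ fun i => (hlaw i).aemeasurable
    have hind : IndepFun Z (u a) P := by
      have h := hindep.indepFun_finset₀ s {a} (by simpa using ha) fun i => (hlaw i).aemeasurable
      exact h.comp measurable_id (measurable_pi_apply (⟨a, by simp⟩ : ({a} : Finset ι)))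
    have hprod := hind.map_prod_eq_prod_map_map hZm (hlaw a).aemeasurable
    set A : Set ((s → Metric.sphere (0 : EuclideanSpace ℝ (Fin D)) 1) ×
        Metric.sphere (0 : EuclideanSpace ℝ (Fin D)) 1) :=
      {p | LinearIndependent ℝ (fun i => (p.1 i : EuclideanSpace ℝ (Fin D))) ∧
        (p.2 : EuclideanSpace ℝ (Fin D)) ∈
          Submodule.span ℝ (Set.range fun i => (p.1 i : EuclideanSpace ℝ (Fin D)))} with hA
    have hAm : MeasurableSet A := by
      have h1 : IsOpen {p : (s → Metric.sphere (0 : EuclideanSpace ℝ (Fin D)) 1) ×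
          Metric.sphere (0 : EuclideanSpace ℝ (Fin D)) 1 |
          LinearIndependent ℝ (fun i => (p.1 i : EuclideanSpace ℝ (Fin D)))} :=
        isOpen_linearIndependent_comp (by fun_prop)
      have h2 : IsOpen {p : (s → Metric.sphere (0 : EuclideanSpace ℝ (Fin D)) 1) ×
          Metric.sphere (0 : EuclideanSpace ℝ (Fin D)) 1 |
          LinearIndependent ℝ (fun o : Option s => (Option.casesOn' o
            (p.2 : EuclideanSpace ℝ (Fin D)) fun i => (p.1 i : EuclideanSpace ℝ (Fin D))))} := by
        refine isOpen_linearIndependent_comp (continuous_pi fun o => ?_)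
        cases o <;> simp only [Option.casesOn'] <;> fun_prop
      -- `A` is a difference of open sets: the old family is independent, the enlarged one is not.
      convert h1.measurableSet.diff h2.measurableSet using 1
      ext p
      simp only [hA, Set.mem_ofPred_eq, Set.mem_sdiff, linearIndependent_option']
      tauto
    have := isProbabilityMeasure_uniformSphere (D := D) (by omega)
    have hA0 : P.map (fun ω => (Z ω, u a ω)) A = 0 := by
      rw [hprod, (hlaw a).map_eq, Measure.measure_prod_null hAm]
      refine Filter.Eventually.of_forall fun y => ?_
      by_cases hy : LinearIndependent ℝ (fun i => (y i : EuclideanSpace ℝ (Fin D)))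
      · refine measure_mono_null (fun z hz => hz.2) (uniformSphere_submodule
          (V := Submodule.span ℝ (Set.range fun i => (y i : EuclideanSpace ℝ (Fin D)))) ?_)
        intro htop
        have h := finrank_span_eq_card hy
        rw [htop, finrank_top, finrank_euclideanSpace_fin, Fintype.card_coe] at h
        omega
      · exact measure_mono_null (fun z hz => hy hz.1) measure_empty
    have hA0' : ∀ᵐ ω ∂P, (Z ω, u a ω) ∉ A := by
      rw [Measure.map_apply_of_aemeasurable (hZm.prodMk (hlaw a).aemeasurable) hAm] at hA0
      exact measure_eq_zero_iff_ae_notMem.1 hA0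
    filter_upwards [ih', hA0'] with ω h1 h2
    rw [Finset.coe_insert, linearIndepOn_insert (by simpa using ha)]
    refine ⟨h1, fun h3 => h2 ⟨h1, ?_⟩⟩
    rw [Set.image_eq_range] at h3
    exact h3

/-- The law of finitely many independent uniform points of the sphere is invariant under
sign changes. -/
theorem measure_inHalfspace_flip_eq (hD : 1 ≤ D) {ι : Type*} [Fintype ι] [DecidableEq ι]
    {u : ι → Ω → Metric.sphere (0 : EuclideanSpace ℝ (Fin D)) 1}
    (hlaw : ∀ i, HasLaw (u i) (uniformSphere D) P) (hindep : iIndepFun u P) (s : Finset ι) :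
    P {ω | InHalfspace fun i => if i ∈ s then (u i ω : EuclideanSpace ℝ (Fin D)) else -u i ω} =
      P {ω | InHalfspace fun i => (u i ω : EuclideanSpace ℝ (Fin D))} := by
  have := isProbabilityMeasure_uniformSphere hD
  set U : Ω → (ι → Metric.sphere (0 : EuclideanSpace ℝ (Fin D)) 1) := fun ω i => u i ω with hU
  have hUm : AEMeasurable U P := aemeasurable_pi_lambda _ fun i => (hlaw i).aemeasurable
  have hmap : P.map U = Measure.pi fun _ => uniformSphere D := by
    rw [(iIndepFun_iff_map_fun_eq_pi_map fun i => (hlaw i).aemeasurable).1 hindep]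
    simp_rw [fun i => (hlaw i).map_eq]
  have hflip : MeasurePreserving
      (fun (y : ι → Metric.sphere (0 : EuclideanSpace ℝ (Fin D)) 1) i =>
        (if i ∈ s then id else fun z => -z) (y i))
      (Measure.pi fun _ => uniformSphere D) (Measure.pi fun _ => uniformSphere D) := by
    refine measurePreserving_pi _ _ fun i => ?_
    split_ifs
    · exact .id _
    · exact measurePreserving_neg_uniformSphere
  have hB := (isClosed_inHalfspace (D := D) (ι := ι)).measurableSet
  have h1 := hflip.measure_preimage hB.nullMeasurableSet
  rw [← hmap, Measure.map_apply_of_aemeasurable hUm hB,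
    Measure.map_apply_of_aemeasurable hUm (hflip.measurable hB)] at h1
  convert h1 using 2
  · ext ω
    simp only [Set.mem_ofPred_eq, Set.mem_preimage]
    congr! 2 with i
    split_ifs <;> simp [hU]
  · rfl

theorem measureReal_inHalfspace_le (hD : 1 ≤ D) {ι : Type*} [Fintype ι]
    {u : ι → Ω → Metric.sphere (0 : EuclideanSpace ℝ (Fin D)) 1}
    (hlaw : ∀ i, HasLaw (u i) (uniformSphere D) P) (hindep : iIndepFun u P) :
    P.real {ω | InHalfspace fun i => (u i ω : EuclideanSpace ℝ (Fin D))} ≤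
      5 ^ D * (3 / 5) ^ Fintype.card ι := by
  classical
  set F : Finset ι → Set Ω := fun s =>
    {ω | InHalfspace fun i => if i ∈ s then (u i ω : EuclideanSpace ℝ (Fin D)) else -u i ω} with hF
  have hFm : ∀ s, NullMeasurableSet (F s) P := by
    intro s
    have hUm : AEMeasurable (fun ω i => if i ∈ s then u i ω else -u i ω) P :=
      aemeasurable_pi_lambda _ fun i => by
        split_ifs
        · exact (hlaw i).aemeasurable
        · exact continuous_neg.measurable.comp_aemeasurable (hlaw i).aemeasurable
    have h := hUm.nullMeasurableSet_preimage
      (isClosed_inHalfspace (D := D) (ι := ι)).measurableSet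
    convert h using 1
    ext ω
    simp only [hF, Set.mem_ofPred_eq, Set.mem_preimage]
    congr! 2 with i
    split_ifs <;> simp
  have hgp : ∀ᵐ ω ∂P, ∀ s : Finset ι, s.card = Module.finrank ℝ (EuclideanSpace ℝ (Fin D)) →
      LinearIndepOn ℝ (fun i => (u i ω : EuclideanSpace ℝ (Fin D))) (s : Set ι) := by
    rw [ae_all_iff]
    intro s
    by_cases hs : s.card = Module.finrank ℝ (EuclideanSpace ℝ (Fin D))
    · filter_upwards [ae_linearIndepOn_uniformSphere hlaw hindep s
        (by rw [hs, finrank_euclideanSpace_fin])] with ω h _ using h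
    · exact Filter.Eventually.of_forall fun ω h => absurd h hs
  have hint : ∀ s, Integrable ((F s).indicator fun _ => (1 : ℝ)) P := fun s =>
    (integrable_const 1).indicator₀ (hFm s)
  have hsum : ∑ s : Finset ι, P.real (F s) ≤ 5 ^ D * (6 / 5) ^ Fintype.card ι := by
    -- The sum is the expected number of sign patterns.
    calc ∑ s : Finset ι, P.real (F s)
        = ∑ s : Finset ι, ∫ ω, (F s).indicator (fun _ => (1 : ℝ)) ω ∂P := by
          refine Finset.sum_congr rfl fun s _ => ?_
          rw [integral_indicator₀ (hFm s)]
          simp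
      _ = ∫ ω, ∑ s : Finset ι, (F s).indicator (fun _ => (1 : ℝ)) ω ∂P :=
          (integral_finsetSum _ fun s _ => hint s).symm
      _ ≤ ∫ _, 5 ^ D * (6 / 5) ^ Fintype.card ι ∂P := by
          refine integral_mono_ae (integrable_finsetSum _ fun s _ => hint s)
            (integrable_const _) ?_
          filter_upwards [hgp] with ω hω
          have h := card_signPatterns_le hω
          rw [finrank_euclideanSpace_fin] at h
          refine le_trans (le_of_eq ?_) h
          simp [Set.indicator_apply, signPatterns, hF]
      _ = 5 ^ D * (6 / 5) ^ Fintype.card ι := by simp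
  have hconst : ∀ s, P.real (F s) =
      P.real {ω | InHalfspace fun i => (u i ω : EuclideanSpace ℝ (Fin D))} := fun s =>
    congrArg ENNReal.toReal (measure_inHalfspace_flip_eq hD hlaw hindep s)
  rw [Finset.sum_congr rfl fun s _ => hconst s, Finset.sum_const, Finset.card_univ,
    Fintype.card_finset, nsmul_eq_mul] at hsum
  push_cast at hsum
  have h65 : (6 / 5 : ℝ) ^ Fintype.card ι = 2 ^ Fintype.card ι * (3 / 5) ^ Fintype.card ι := by
    rw [← mul_pow]; norm_num
  rw [h65, mul_left_comm] at hsum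
  exact le_of_mul_le_mul_left hsum (by positivity)

end Probability

theorem mainTheorem2 {D : ℕ} (hD : 1 ≤ D)
    {Ω : Type*} [MeasurableSpace Ω] (P : Measure Ω) [IsProbabilityMeasure P]
    (C₀ : ConvexCone ℝ (EuclideanSpace ℝ (Fin D)))
    (u : ℕ → Ω → Metric.sphere (0 : EuclideanSpace ℝ (Fin D)) 1)
    (hlaw : ∀ i, HasLaw (u i) (uniformSphere D) P)
    (hindep : iIndepFun u P)
    (η : ℝ) (hη : 0 < η) :
    1 - η ≤ P.real {ω | ∀ n : ℕ, 4 * (D : ℝ) + 2 * Real.log (1 / η) ≤ (n : ℝ) →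
      (expandedCone C₀ (fun i => (u i ω : EuclideanSpace ℝ (Fin D))) n :
        Set (EuclideanSpace ℝ (Fin D))) = Set.univ} := by
  by_cases hη1 : 1 ≤ η
  · exact (sub_nonpos.2 hη1).trans measureReal_nonneg
  set N := ⌈4 * (D : ℝ) + 2 * Real.log (1 / η)⌉₊ with hN
  have hNle : 4 * (D : ℝ) + 2 * Real.log (1 / η) ≤ N := Nat.le_ceil _
  have hNpos : 0 < N := by
    rw [hN, Nat.ceil_pos]
    have h1 : 0 ≤ Real.log (1 / η) :=
      Real.log_nonneg ((one_le_div hη).2 (not_le.1 hη1).le)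
    have h2 : (1 : ℝ) ≤ D := by exact_mod_cast hD
    linarith
  have : Nonempty (Fin N) := ⟨⟨0, hNpos⟩⟩
  have hbad := (measureReal_inHalfspace_le hD (fun i : Fin N => hlaw i)
    (hindep.precomp Fin.val_injective))
  rw [Fintype.card_fin] at hbad
  replace hbad := hbad.trans (five_pow_mul_le hη hNle)
  set A := {ω | ∀ n : ℕ, 4 * (D : ℝ) + 2 * Real.log (1 / η) ≤ (n : ℝ) →
      (expandedCone C₀ (fun i => (u i ω : EuclideanSpace ℝ (Fin D))) n :
        Set (EuclideanSpace ℝ (Fin D))) = Set.univ}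
  set B := {ω | InHalfspace fun i : Fin N => (u i ω : EuclideanSpace ℝ (Fin D))}
  have hAB : A ∪ B = Set.univ := by
    refine Set.eq_univ_of_forall fun ω => or_iff_not_imp_right.2 fun hω n hn => ?_
    refine Set.eq_univ_of_univ_subset ?_
    rw [← hull_range_eq_univ_of_not_inHalfspace hω]
    refine ConvexCone.hull_min ?_
    rintro _ ⟨i, rfl⟩
    exact ConvexCone.subset_hull (Or.inr ⟨i, i.2.trans_le (Nat.ceil_le.2 hn), rfl⟩)
  -- Subadditivity needs no measurability of `A`.
  have h1 := measureReal_union_le (μ := P) A B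
  rw [hAB, probReal_univ] at h1
  linarith
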